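/- **Setting.** Let $\mathcal I$, $\mathcal B$, $\mathcal X$ be finite sets of agents, branches and contracts; each contract $x$ has an agent $\mathbf i(x)$ and a branch $\mathbf b(x)$. For $X\subseteq\mathcal X$ write $X_i=\{x\in X:\mathbf i(x)=i\}$ and $X_b=\{x\in X:\mathbf b(x)=b\}$. Each agent $i$ has a strict linear preference $P_i$ over $\mathcal X_i\cup\{\emptyset_i\}$; $C^i(X)$ consists of the $P_i$-best contract in $X_i$ that is preferred to $\emptyset_i$, and is empty if there is none. **SSPwCT choice rules.** Each branch $b$ has a physical capacity $n_b$, original seats $o^1,\dots,o^{n_b}$ and associated shadow seats $e^1,\dots,e^{n_b}$ (each kind numbered by its precedence order), a location vector $(l_1,\dots,l_{n_b})$ with $k\le l_k\le n_b$ and $l_{k-1}\le l_k$, where $l_k$ is the number of original seats that precede $e^k$, a capacity transfer vector $(q^1,\dots,q^{n_b})\in\{0,1\}^{n_b}$, and for each seat a strict linear priority order over $\mathcal X_b\cup\{\emptyset\}$. Given a set $X$ of contracts, the seats are processed in the order determined by the precedence orders and the location vector. An original seat, or a shadow seat $e^k$ such that $q^k=1$ and $o^k$ was left empty, is assigned the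 contract of highest priority for it among the contracts in $X_b$ of agents to whom no earlier seat of $b$ was assigned (and is left empty if $\emptyset$ ranks above all of these); any other shadow seat is left empty. $C^b(X)$ is the set of assigned contracts. **Stability and strategy-proofness.** A set $X\subseteq\mathcal X$ is *feasible* if $|X_i|\le1$ for all $i\in\mathcal I$ and $|X_b|\le n_b$ for all $b\in\mathcal B$. It is *stable* if it is feasible, $C^i(X)=X_i$ for all $i$ and $C^b(X)=X_b$ for all $b$, and there are no branch $b$ and set of contracts $Y$ with $Y_b\ne C^b(X)$ such that $Y_b=C^b(X\cup Y)$ and $Y_i=C^i(X\cup Y)$ for every agent $i$ with a contract in $Y$. A mechanism, i.e. a map from preference profiles to sets of contracts, is *stable* if its outcome is stable at every profile, and *strategy-proof* if at no profile $P$ does any agent $i$ have a report $\widetilde P_i$ such that $i$ strictly prefers, according to $P_i$, the outcome at $(\widetilde P_i,P_{-i})$ to the outcome at $P$. **Cumulative offer mechanism (COM).** Start with no contract offered. At each step an arbitrarily chosen agent for whom no branch currently holds a contract proposes her most preferred acceptable contract among those not rejected so far, and this contract is added to the set $A$ of offered contracts; branch $b$ then holds $C^b(A_b)$ and rejects the other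 contracts in $A_b$. The algorithm stops when every agent either has a held contract or has had all her acceptable contracts rejected; the outcome is $\bigcup_b C^b(A_b)$. **Theorem 1.** If every branch uses an SSPwCT choice rule, then the cumulative offer algorithm terminates for every preference profile and every choice of proposers, so that the COM is defined; and the COM, whatever the order of proposers at each profile, is stable and strategy-proof. -/

import Mathlib

noncomputable section

namespace SSPwCT

/-- The contracts `x` with `f x = c`.  With `f` the agent map this is the set of contracts of
agent `c`; with `f` the branch map it is the set of contracts of branch `c`. -/
abbrev Fiber {X : Type*} {K : Type*} (f : X → K) (c : K) : Type _ := {x : X // f x = c}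

/-- A strict (linear) ranking of `α ∪ {∅}`; the null option is `none`.
`R.rel u v` reads "`u` is strictly better than `v`". -/
structure StrictRanking (α : Type*) where
  rel : Option α → Option α → Prop
  strictTotal : IsStrictTotalOrder (Option α) rel

open Classical in
/-- The best element of `A` if some element of `A` is better than `∅`, and `∅` otherwise. -/
def StrictRanking.max {α : Type*} (R : StrictRanking α) (A : Finset α) : Option α :=
  if h : ∃ x ∈ A, R.rel (some x) none ∧ ∀ y ∈ A, y ≠ x → R.rel (some x) (some y)
  then some h.choose else none

/-- A preference profile: each agent strictly ranks her own contracts and the outside option. -/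
abbrev PrefProfile {I X : Type*} (agent : X → I) : Type _ :=
  ∀ i : I, StrictRanking (Fiber agent i)

/-! ### Slot-specific priorities with capacity transfers -/

/-- The seats of a branch of physical capacity `n`: `Sum.inl k` is the `k`-th original seat,
`Sum.inr k` is the shadow seat associated with it (indices start at `0`).  The seats of each
kind are numbered along the branch's precedence order over that kind. -/
abbrev Slot (n : ℕ) : Type := Fin n ⊕ Fin n

/-- The data that parametrize the choice rule of branch `b`. -/
structure BranchData {B X : Type*} (branch : X → B) (b : B) where
  /-- physical capacity -/
  n : ℕ
  /-- location vector: `loc k` is the number of original seats preceding the shadow seat `k` -/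
  loc : Fin n → ℕ
  /-- no shadow seat comes before its associated original seat -/
  lt_loc : ∀ k : Fin n, (k : ℕ) + 1 ≤ loc k
  loc_le : ∀ k : Fin n, loc k ≤ n
  loc_mono : Monotone loc
  /-- capacity transfer scheme: `true` iff the capacity of the original seat `k` is transferred
  to the shadow seat `k` when the original seat is not filled -/
  transfer : Fin n → Bool
  /-- priority order of each seat over the contracts of `b` and the null contract -/
  priority : Slot n → StrictRanking (Fiber branch b)

namespace BranchData

variable {I B X : Type*} {branch : X → B} {b : B}

/-- The order in which seats are filled: after the original seat number `m + 1` come exactly the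
shadow seats (in their order) that are preceded by `m + 1` original seats. -/
def slotOrder (D : BranchData branch b) : List (Slot D.n) :=
  (List.finRange D.n).flatMap fun m =>
    Sum.inl m :: ((List.finRange D.n).filter fun k => D.loc k = (m : ℕ) + 1).map Sum.inr

/-- Given the assignment `μ` so far, whether a seat has capacity when its turn comes. -/
def Active (D : BranchData branch b) (μ : Slot D.n → Option (Fiber branch b)) :
    Slot D.n → Prop
  | Sum.inl _ => True
  | Sum.inr k => D.transfer k = true ∧ μ (Sum.inl k) = none

open Classical in
/-- Contracts of `A` whose agent has no contract assigned to a seat so far. -/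
def available (agent : X → I) (D : BranchData branch b) (A : Finset (Fiber branch b))
    (μ : Slot D.n → Option (Fiber branch b)) : Finset (Fiber branch b) :=
  A.filter fun x => ∀ s y, μ s = some y → agent y ≠ agent x

open Classical in
/-- Process one seat: an active seat takes its highest-priority available contract. -/
def fillSlot (agent : X → I) (D : BranchData branch b) (A : Finset (Fiber branch b))
    (μ : Slot D.n → Option (Fiber branch b)) (s : Slot D.n) :
    Slot D.n → Option (Fiber branch b) :=
  Function.update μ s
    (if D.Active μ s then (D.priority s).max (D.available agent A μ) else none)

/-- The assignment of contracts to seats once all seats have been processed in order. -/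
def assignment (agent : X → I) (D : BranchData branch b) (A : Finset (Fiber branch b)) :
    Slot D.n → Option (Fiber branch b) :=
  D.slotOrder.foldl (D.fillSlot agent A) fun _ => none

open Classical in
/-- The SSPwCT choice rule of branch `b`. -/
def choice (agent : X → I) (D : BranchData branch b) (A : Finset X) : Finset X :=
  A.filter fun x => ∃ (h : branch x = b) (s : Slot D.n),
    D.assignment agent (A.subtype fun y => branch y = b) s = some ⟨x, h⟩

end BranchData

/-! ### Outcomes, stability, strategy-proofness -/

section Matching

variable {I B X : Type*} [DecidableEq I] [DecidableEq B] [DecidableEq X]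

/-- `A_i` (with the agent map), or `A_b` (with the branch map). -/
def restrict {K : Type*} [DecidableEq K] (f : X → K) (c : K) (A : Finset X) : Finset X :=
  A.filter fun x => f x = c

/-- The choice rule of agent `i`: her best acceptable contract in `A`, if there is one. -/
def agentChoice (agent : X → I) (P : PrefProfile agent) (i : I) (A : Finset X) : Finset X :=
  ((P i).max (A.subtype fun x => agent x = i)).toFinset.map (Function.Embedding.subtype _)

/-- At most one contract per agent, and no branch exceeds its capacity `cap b`. -/
def Feasible (agent : X → I) (branch : X → B) (cap : B → ℕ) (A : Finset X) : Prop :=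
  (∀ i, (restrict agent i A).card ≤ 1) ∧ ∀ b, (restrict branch b A).card ≤ cap b

/-- Stability of an outcome: feasibility, individual rationality and no blocking. -/
def StableOutcome (agent : X → I) (branch : X → B) (cap : B → ℕ)
    (C : B → Finset X → Finset X) (P : PrefProfile agent) (A : Finset X) : Prop :=
  Feasible agent branch cap A ∧
  (∀ i, agentChoice agent P i A = restrict agent i A) ∧
  (∀ b, C b A = restrict branch b A) ∧
  ¬ ∃ (b : B) (Y : Finset X), restrict branch b Y ≠ C b A ∧
      restrict branch b Y = C b (A ∪ Y) ∧
      ∀ i ∈ Y.image agent, restrict agent i Y = agentChoice agent P i (A ∪ Y)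

/-- A mechanism maps preference profiles to outcomes. -/
abbrev Mechanism (agent : X → I) : Type _ := PrefProfile agent → Finset X

def Mechanism.Stable {agent : X → I} (Ψ : Mechanism agent) (branch : X → B) (cap : B → ℕ)
    (C : B → Finset X → Finset X) : Prop :=
  ∀ P, StableOutcome agent branch cap C P (Ψ P)

/-- `o` is what agent `i` receives in `A`: her only contract in `A`, or nothing. -/
def Receives (agent : X → I) (i : I) (A : Finset X) (o : Option (Fiber agent i)) : Prop :=
  ∀ x : Fiber agent i, (x : X) ∈ A ↔ o = some x

/-- Agent `i` with ranking `R` strictly prefers the outcome `A` to the outcome `A'`. -/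
def Prefers (agent : X → I) (i : I) (R : StrictRanking (Fiber agent i)) (A A' : Finset X) :
    Prop :=
  ∃ o o', Receives agent i A o ∧ Receives agent i A' o' ∧ R.rel o o'

def Mechanism.StrategyProof {agent : X → I} (Ψ : Mechanism agent) : Prop :=
  ∀ (P : PrefProfile agent) (i : I), ¬ ∃ R : StrictRanking (Fiber agent i),
    Prefers agent i (P i) (Ψ (Function.update P i R)) (Ψ P)

/-! ### The cumulative offer mechanism -/

variable [Fintype B] [Fintype X]

/-- The contracts held by the branches when the set of contracts offered so far is `A`. -/
def held (branch : X → B) (C : B → Finset X → Finset X) (A : Finset X) : Finset X :=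
  Finset.univ.biUnion fun b => C b (restrict branch b A)

/-- The offered contracts that are not held.  For an agent without a held contract, every
contract of hers that was ever rejected is among these. -/
def rejected (branch : X → B) (C : B → Finset X → Finset X) (A : Finset X) : Finset X :=
  A \ held branch C A

/-- One step: some agent for whom no contract is held proposes her favorite acceptable contract
among those that have not been rejected; the set of offered contracts grows from `A` to `A'`. -/
def OfferStep (agent : X → I) (branch : X → B) (C : B → Finset X → Finset X)
    (P : PrefProfile agent) (A A' : Finset X) : Prop :=
  ∃ i : I, (∀ x ∈ held branch C A, agent x ≠ i) ∧
    ∃ x : Fiber agent i,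
      (P i).max ((rejected branch C A)ᶜ.subtype fun y => agent y = i) = some x ∧
      A' = insert (x : X) A

/-- Every agent has a held contract or has had all her acceptable contracts rejected. -/
def OfferTerminal (agent : X → I) (branch : X → B) (C : B → Finset X → Finset X)
    (P : PrefProfile agent) (A : Finset X) : Prop :=
  ∀ i : I, (∃ x ∈ held branch C A, agent x = i) ∨
    ∀ x : Fiber agent i, (P i).rel (some x) none → (x : X) ∈ rejected branch C A

/-- `Z` is the outcome of a run of the cumulative offer algorithm, for some sequence of
proposers. -/
def IsCOMOutcome (agent : X → I) (branch : X → B) (C : B → Finset X → Finset X)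
    (P : PrefProfile agent) (Z : Finset X) : Prop :=
  ∃ A : Finset X, Relation.ReflTransGen (OfferStep agent branch C P) ∅ A ∧
    OfferTerminal agent branch C P A ∧ Z = held branch C A

/-- `Ψ` is a cumulative offer mechanism with respect to `C`: at each profile it returns the
outcome of a run of the algorithm (the order of proposers being arbitrary). -/
def Mechanism.IsCOM {agent : X → I} (Ψ : Mechanism agent) (branch : X → B)
    (C : B → Finset X → Finset X) : Prop :=
  ∀ P, IsCOMOutcome agent branch C P (Ψ P)

/-- No run of the cumulative offer algorithm, whatever the order of proposers, is infinite. -/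
def OffersTerminate (agent : X → I) (branch : X → B) (C : B → Finset X → Finset X) : Prop :=
  ∀ P : PrefProfile agent, ¬ ∃ A : ℕ → Finset X,
    A 0 = ∅ ∧ ∀ t, OfferStep agent branch C P (A t) (A (t + 1))

end Matching

end SSPwCT

end

/-! An SSPwCT rule need not be substitutable: a rejected contract can be recalled once its agent
loses an earlier seat. The remedy is a completion. In `D.choice id` every contract counts as its own
agent, so a branch may take several contracts of one agent. If the completion happens to take at
most one contract per agent, it agrees with the true rule (`BranchData.choice_eq_of_injOn`).

The completion is substitutable and obeys the law of aggregate demand (`BranchData.choice_id_mono`).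
This is proved by filling the seats in parallel from `A` and from `A` plus one contract: the
unassigned contracts always coincide or differ by one extra contract. A capacity transfer only
switches between these two situations (`BranchData.Linked.fillSlot`).

Substitutability keeps an agent whose contract is held from acquiring a second one, because only
agents without a held contract propose and nothing rejected returns
(`ContractOrder.Reachable.injOn`). So every run with the true rules is a run with the completions
(`reachable_of_offerSteps`), and the argument can work with the completions throughout.

Stability: the contracts of a blocking set have all been offered already, and adding back rejected
offers does not change a choice (`choice_eq_of_between`). Strategy-proofness: complete runs make the
same offers in any order (`ContractOrder.Reachable.subset`), and a profitable misreport would let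
fewer offers lead to more held contracts, against the law of aggregate demand
(`ContractOrder.no_profitable_report`). Termination only needs that the offers grow strictly inside
a finite set. -/

namespace SSPwCT

/-! ### Strict rankings and their maxima -/

namespace StrictRanking

variable {α : Type*} (R : StrictRanking α)

theorem asymm {u v : Option α} (h : R.rel u v) : ¬ R.rel v u := by
  have := R.strictTotal
  exact fun h' => irrefl_of R.rel u (trans_of R.rel h h')

theorem trans {u v w : Option α} (h : R.rel u v) (h' : R.rel v w) : R.rel u w := by
  have := R.strictTotal
  exact trans_of R.rel h h'

theorem irrefl (u : Option α) : ¬ R.rel u u := fun h => R.asymm h h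

theorem total {u v : Option α} (h : u ≠ v) : R.rel u v ∨ R.rel v u := by
  have := R.strictTotal
  rcases trichotomous_of R.rel u v with h' | h' | h'
  exacts [Or.inl h', absurd h' h, Or.inr h']

theorem max_eq_some {A : Finset α} {x : α} :
    R.max A = some x ↔
      x ∈ A ∧ R.rel (some x) none ∧ ∀ y ∈ A, y ≠ x → R.rel (some x) (some y) := by
  unfold max
  split_ifs with h
  · have hc := h.choose_spec
    constructor
    · rintro hx
      rw [Option.some.injEq] at hx
      rwa [← hx]
    · rintro ⟨hx, -, hx'⟩
      by_contra hne
      have hne : h.choose ≠ x := fun h' => hne (congrArg some h')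
      exact R.asymm (hx' _ hc.1 hne) (hc.2.2 x hx hne.symm)
  · simp only [false_iff]
    exact fun h' => h ⟨x, h'⟩

/-- The definition of `max` returns `none` whenever no best element exists. The content here is that
a nonempty finite set always has one, so `none` can only mean that nothing is acceptable. -/
theorem max_eq_none {A : Finset α} :
    R.max A = none ↔ ∀ x ∈ A, ¬ R.rel (some x) none := by
  constructor
  · intro hA x hx hacc
    have key : ∀ S : Finset α, S.Nonempty →
        ∃ x ∈ S, ∀ y ∈ S, y ≠ x → R.rel (some x) (some y) := by
      classical
      intro S hS
      induction hS using Finset.Nonempty.cons_induction with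
      | singleton a => exact ⟨a, by simp, by simp⟩
      | cons a s ha hs ih =>
        obtain ⟨m, hm, hm'⟩ := ih
        have hne : a ≠ m := fun h => ha (h ▸ hm)
        rcases R.total (u := some a) (v := some m) (by simpa using hne) with h | h
        · refine ⟨a, by simp, fun y hy hya => ?_⟩
          rcases Finset.mem_cons.1 hy with rfl | hy
          · exact absurd rfl hya
          · by_cases hym : y = m
            · rwa [hym]
            · exact R.trans h (hm' y hy hym)
        · refine ⟨m, by simp [hm], fun y hy hym => ?_⟩
          rcases Finset.mem_cons.1 hy with rfl | hy
          · exact h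
          · exact hm' y hy hym
    obtain ⟨m, hm, hm'⟩ := key A ⟨x, hx⟩
    have : R.max A = some m := by
      refine R.max_eq_some.2 ⟨hm, ?_, hm'⟩
      by_cases hxm : x = m
      · rwa [← hxm]
      · exact R.trans (hm' x hx hxm) hacc
    rw [hA] at this
    exact absurd this (by simp)
  · intro h
    rcases hm : R.max A with _ | x
    · rfl
    · have := R.max_eq_some.1 hm
      exact absurd this.2.1 (h x this.1)

theorem max_subset_some {A A' : Finset α} (hA : A ⊆ A') {x : α} (h : R.max A' = some x)
    (hx : x ∈ A) : R.max A = some x := by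
  obtain ⟨-, h1, h2⟩ := R.max_eq_some.1 h
  exact R.max_eq_some.2 ⟨hx, h1, fun y hy => h2 y (hA hy)⟩

theorem max_subset_none {A A' : Finset α} (hA : A ⊆ A') (h : R.max A' = none) :
    R.max A = none :=
  R.max_eq_none.2 fun x hx => R.max_eq_none.1 h x (hA hx)

end StrictRanking

/-! ### Filling the seats of one branch -/

namespace BranchData

variable {I B X : Type*} {branch : X → B} {b : B} (D : BranchData branch b)

theorem mem_slot_block {m : Fin D.n} {s : Slot D.n} :
    s ∈ (Sum.inl m :: ((List.finRange D.n).filter fun k => D.loc k = (m : ℕ) + 1).map Sum.inr :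
      List (Slot D.n)) ↔ s = Sum.inl m ∨ ∃ k, D.loc k = (m : ℕ) + 1 ∧ s = Sum.inr k := by
  simp [eq_comm]

theorem nodup_slotOrder : D.slotOrder.Nodup := by
  unfold slotOrder
  rw [List.nodup_flatMap]
  constructor
  · intro m _
    refine List.nodup_cons.2 ⟨by simp, ?_⟩
    exact ((List.nodup_finRange _).filter _).map Sum.inr_injective
  · refine (List.nodup_finRange D.n).imp ?_
    intro m m' hne s hs hs'
    rw [mem_slot_block] at hs hs'
    rcases hs with rfl | ⟨k, hk, rfl⟩ <;> rcases hs' with h | ⟨k', hk', h⟩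
    · exact hne (Sum.inl_injective h)
    · cases h
    · cases h
    · cases h
      exact hne (Fin.ext (by omega))

/-- By `lt_loc`, at least `k + 1` original seats precede the shadow seat `k` (counting from `0`), so
its own original seat is among them. Whether capacity is transferred is therefore settled before the
shadow seat is reached. -/
theorem slotOrder_pairwise :
    D.slotOrder.Pairwise fun s t => ∀ k, s = Sum.inr k → t ≠ Sum.inl k := by
  unfold slotOrder
  rw [List.pairwise_flatMap]
  constructor
  · intro m _
    rw [List.pairwise_cons]
    refine ⟨by simp, ?_⟩
    rw [List.pairwise_map]
    exact List.pairwise_of_forall (by simp)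
  · refine (List.pairwise_lt_finRange D.n).imp ?_
    intro m m' hlt s hs t ht k hk hkt
    rw [mem_slot_block] at hs ht
    subst hk hkt
    rcases hs with h | ⟨j, hj, h⟩
    · cases h
    rcases ht with h' | ⟨j', hj', h'⟩
    · have := D.lt_loc k
      rw [Sum.inr_injective h, hj] at this
      have := congrArg Fin.val (Sum.inr_injective h)
      have := congrArg Fin.val (Sum.inl_injective h')
      have : (m : ℕ) < m' := hlt
      omega
    · cases h'

/-- The contracts of `A` that are assigned to some seat. -/
noncomputable def picked (agent : X → I) (A : Finset (Fiber branch b)) :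
    Finset (Fiber branch b) := by
  classical
  exact A.filter fun x => ∃ s, D.assignment agent A s = some x

section Seats

variable (agent : X → I) (A : Finset (Fiber branch b))

/-- The contract that seat `s` takes when its turn comes. -/
noncomputable def pick (μ : Slot D.n → Option (Fiber branch b)) (s : Slot D.n) : Option (Fiber branch b) :=
  open Classical in
  if D.Active μ s then (D.priority s).max (D.available agent A μ) else none

theorem fillSlot_eq (μ : Slot D.n → Option (Fiber branch b)) (s : Slot D.n) :
    D.fillSlot agent A μ s = Function.update μ s (D.pick agent A μ s) := by
  classical
  unfold fillSlot pick
  congr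

variable {D agent A}

theorem mem_available {μ : Slot D.n → Option (Fiber branch b)} {x : Fiber branch b} :
    x ∈ D.available agent A μ ↔ x ∈ A ∧ ∀ s y, μ s = some y → agent y ≠ agent x := by
  simp [available]

theorem mem_available_of_pick {μ : Slot D.n → Option (Fiber branch b)} {s : Slot D.n}
    {x : Fiber branch b} (h : D.pick agent A μ s = some x) : x ∈ D.available agent A μ := by
  unfold pick at h
  split_ifs at h
  exact ((D.priority s).max_eq_some.1 h).1

theorem foldl_fillSlot_of_notMem (L : List (Slot D.n)) (μ : Slot D.n → Option (Fiber branch b))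
    {s : Slot D.n} (hs : s ∉ L) : L.foldl (D.fillSlot agent A) μ s = μ s := by
  induction L generalizing μ with
  | nil => rfl
  | cons t L ih =>
    rw [List.mem_cons, not_or] at hs
    rw [List.foldl_cons, ih _ hs.2, fillSlot_eq, Function.update_of_ne hs.1]

theorem foldl_fillSlot_mem (L : List (Slot D.n)) (μ : Slot D.n → Option (Fiber branch b))
    (hμ : ∀ s x, μ s = some x → x ∈ A) {s : Slot D.n} {x : Fiber branch b}
    (h : L.foldl (D.fillSlot agent A) μ s = some x) : x ∈ A := by
  induction L generalizing μ with
  | nil => exact hμ s x h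
  | cons t L ih =>
    refine ih _ (fun s' x' h' => ?_) h
    rw [fillSlot_eq] at h'
    by_cases hst : s' = t
    · subst hst
      rw [Function.update_self] at h'
      exact (mem_available.1 (mem_available_of_pick h')).1
    · rw [Function.update_of_ne hst] at h'
      exact hμ _ _ h'

theorem assignment_mem {s : Slot D.n} {x : Fiber branch b}
    (h : D.assignment agent A s = some x) : x ∈ A :=
  foldl_fillSlot_mem _ _ (by simp) h

theorem mem_picked {x : Fiber branch b} :
    x ∈ D.picked agent A ↔ ∃ s, D.assignment agent A s = some x := by
  simp only [picked, Finset.mem_filter, and_iff_right_iff_imp]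
  rintro ⟨s, h⟩
  exact assignment_mem h

/-- An original seat and its shadow seat are never both filled. -/
theorem foldl_fillSlot_exclusive (L : List (Slot D.n)) (hL : L.Nodup)
    (hL' : L.Pairwise fun s t => ∀ k, s = Sum.inr k → t ≠ Sum.inl k)
    (μ : Slot D.n → Option (Fiber branch b))
    (hμ : ∀ k, μ (Sum.inl k) = none ∨ μ (Sum.inr k) = none)
    (hμ' : ∀ k, μ (Sum.inr k) ≠ none → Sum.inl k ∉ L) (k : Fin D.n) :
    L.foldl (D.fillSlot agent A) μ (Sum.inl k) = none ∨
      L.foldl (D.fillSlot agent A) μ (Sum.inr k) = none := by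
  induction L generalizing μ with
  | nil => exact hμ k
  | cons t L ih =>
    rw [List.nodup_cons] at hL
    rw [List.pairwise_cons] at hL'
    rw [List.foldl_cons, fillSlot_eq]
    -- When an original seat is filled, its shadow seat is still empty by `hμ'`; when a shadow seat
    -- is filled, `Active` forces its original seat to be empty. The seat order preserves `hμ'`.
    refine ih hL.2 hL'.2 _ (fun j => ?_) (fun j hj => ?_)
    · rcases t with t | t
      · by_cases hjt : j = t
        · subst hjt
          right
          by_contra hne
          rw [Function.update_of_ne (by simp)] at hne
          exact hμ' j hne (by simp)
        · rw [Function.update_of_ne (by simpa using hjt), Function.update_of_ne (by simp)]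
          exact hμ j
      · by_cases hjt : j = t
        · subst hjt
          rw [Function.update_of_ne (by simp), Function.update_self]
          by_cases h0 : μ (Sum.inl j) = none
          · exact Or.inl h0
          · exact Or.inr (if_neg fun h => h0 h.2)
        · rw [Function.update_of_ne (by simp), Function.update_of_ne (by simpa using hjt)]
          exact hμ j
    · by_cases hjt : Sum.inr j = t
      · subst hjt
        exact fun hmem => hL'.1 _ hmem j rfl rfl
      · rw [Function.update_of_ne hjt] at hj
        exact fun hmem => hμ' j hj (List.mem_cons_of_mem _ hmem)

/-- Each assigned contract is charged to the index `k` of its seat; the two seats with index `k`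
hold at most one contract between them. -/
theorem card_picked_le : (D.picked agent A).card ≤ D.n := by
  classical
  have hex := fun k => foldl_fillSlot_exclusive (agent := agent) (A := A) D.slotOrder
    D.nodup_slotOrder D.slotOrder_pairwise (fun _ => none) (by simp) (by simp) k
  have hsub : D.picked agent A ⊆ Finset.univ.biUnion fun k : Fin D.n =>
      ((D.assignment agent A (Sum.inl k)).or (D.assignment agent A (Sum.inr k))).toFinset := by
    intro x hx
    obtain ⟨s, hs⟩ := mem_picked.1 hx
    rw [Finset.mem_biUnion]
    rcases s with k | k
    · exact ⟨k, Finset.mem_univ _, by simp [hs]⟩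
    · refine ⟨k, Finset.mem_univ _, ?_⟩
      rcases hex k with h | h
      · have h : D.assignment agent A (Sum.inl k) = none := h
        simp [hs, h]
      · have h : D.assignment agent A (Sum.inr k) = none := h
        rw [h] at hs
        cases hs
  refine (Finset.card_le_card hsub).trans (Finset.card_biUnion_le.trans ?_)
  calc _ ≤ ∑ _k : Fin D.n, 1 := Finset.sum_le_sum fun k _ => by
        generalize (D.assignment agent A (Sum.inl k)).or (D.assignment agent A (Sum.inr k)) = o
        cases o <;> simp
    _ = D.n := by simp

/-! ### The completion `D.choice id` -/

/-- If the seats, ignoring who signs the contracts, take at most one contract per agent, then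
taking the agents into account makes no difference. -/
theorem foldl_fillSlot_eq_of_injOn (L : List (Slot D.n)) (hL : L.Nodup)
    (μ : Slot D.n → Option (Fiber branch b)) (hμ : ∀ s ∈ L, μ s = none)
    (h : ∀ s t x y, L.foldl (D.fillSlot id A) μ s = some x →
      L.foldl (D.fillSlot id A) μ t = some y → agent x = agent y → x = y) :
    L.foldl (D.fillSlot agent A) μ = L.foldl (D.fillSlot id A) μ := by
  induction L generalizing μ with
  | nil => rfl
  | cons t L ih =>
    rw [List.nodup_cons] at hL
    have hsub : D.available agent A μ ⊆ D.available id A μ := by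
      intro x hx
      rw [mem_available] at hx ⊢
      exact ⟨hx.1, fun s y hs hyx => hx.2 s y hs (congrArg agent hyx)⟩
    have hpick : D.pick agent A μ t = D.pick id A μ t := by
      -- No seat is processed twice, so this pick survives to the end, where `h` applies to it. If
      -- the agent of the pick already had a seat, `h` would identify the two contracts, yet an
      -- assigned contract is no longer available.
      have hfinal : L.foldl (D.fillSlot id A) (D.fillSlot id A μ t) t = D.pick id A μ t := by
        rw [foldl_fillSlot_of_notMem _ _ hL.1, fillSlot_eq, Function.update_self]
      rw [List.foldl_cons] at h
      by_cases ha : D.Active μ t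
      · simp only [pick, if_pos ha] at hfinal ⊢
        rcases hm : (D.priority t).max (D.available id A μ) with _ | x
        · exact (D.priority t).max_subset_none hsub hm
        · refine (D.priority t).max_subset_some hsub hm ?_
          have hx := mem_available.1 ((D.priority t).max_eq_some.1 hm).1
          refine mem_available.2 ⟨hx.1, fun s y hs hyx => ?_⟩
          have hst : s ∉ t :: L := fun hmem => by simp [hμ s hmem] at hs
          have hs' : L.foldl (D.fillSlot id A) (D.fillSlot id A μ t) s = some y := by
            have := foldl_fillSlot_of_notMem (agent := id) (A := A) (t :: L) μ hst
            rw [List.foldl_cons] at this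
            rw [this, hs]
          have := h s t y x hs' (by rw [hfinal, hm]) hyx
          exact hx.2 s y hs (by rw [this])
      · simp only [pick, if_neg ha]
    have hfill : D.fillSlot agent A μ t = D.fillSlot id A μ t := by
      rw [fillSlot_eq, fillSlot_eq, hpick]
    rw [List.foldl_cons, List.foldl_cons, hfill]
    refine ih hL.2 _ (fun s hs => ?_) h
    have hst : s ≠ t := fun h => hL.1 (h ▸ hs)
    rw [fillSlot_eq, Function.update_of_ne hst]
    exact hμ s (List.mem_cons_of_mem _ hs)

theorem picked_eq_of_injOn
    (h : ∀ x ∈ D.picked id A, ∀ y ∈ D.picked id A, agent x = agent y → x = y) :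
    D.picked agent A = D.picked id A := by
  have : D.assignment agent A = D.assignment id A :=
    foldl_fillSlot_eq_of_injOn _ D.nodup_slotOrder _ (by simp) fun s t x y hs ht =>
      h x (mem_picked.2 ⟨s, hs⟩) y (mem_picked.2 ⟨t, ht⟩)
  ext x
  rw [mem_picked, mem_picked, this]

section Comparison

variable [DecidableEq (Fiber branch b)] {A' : Finset (Fiber branch b)}

/-- This is where ignoring agents pays off: filling a seat removes a single contract, not all
contracts of its agent. The seat must be empty beforehand, since overwriting would release its old
contract. -/
theorem available_update {μ : Slot D.n → Option (Fiber branch b)} {s : Slot D.n}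
    (hs : μ s = none) (v : Fiber branch b) :
    D.available id A (Function.update μ s (some v)) = (D.available id A μ).erase v := by
  ext x
  simp only [mem_available, Finset.mem_erase, id_eq, ne_eq]
  constructor
  · rintro ⟨hx, h⟩
    refine ⟨fun hxv => h s v (by simp) (by rw [hxv]), hx, fun t y ht => h t y ?_⟩
    rw [Function.update_of_ne, ht]
    rintro rfl
    simp [hs] at ht
  · rintro ⟨hne, hx, h⟩
    refine ⟨hx, fun t y ht => ?_⟩
    by_cases hts : t = s
    · subst hts
      rw [Function.update_self, Option.some.injEq] at ht
      subst ht
      exact fun h' => hne (Subtype.ext h'.symm)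
    · rw [Function.update_of_ne hts] at ht
      exact h t y ht

/-- How the assignments from a set of contracts (`μ`) and from a set with one contract more
(`μ'`) are related when the seats in `L` are still to be processed: either `μ'` leaves one
contract more available and each relevant original seat has the same status, or the available
contracts are the same and at most one relevant original seat is filled by `μ'` only. -/
def Linked (A A' : Finset (Fiber branch b)) (L : List (Slot D.n))
    (μ μ' : Slot D.n → Option (Fiber branch b)) : Prop :=
  (∃ w, w ∉ D.available id A μ ∧ D.available id A' μ' = insert w (D.available id A μ) ∧
    ∀ k, Sum.inr k ∈ L → (μ (Sum.inl k) = none ↔ μ' (Sum.inl k) = none)) ∨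
  (D.available id A' μ' = D.available id A μ ∧
    (∀ k, Sum.inr k ∈ L → μ' (Sum.inl k) = none → μ (Sum.inl k) = none) ∧
    ∀ k j, Sum.inr k ∈ L → Sum.inr j ∈ L →
      μ (Sum.inl k) = none → μ' (Sum.inl k) ≠ none →
      μ (Sum.inl j) = none → μ' (Sum.inl j) ≠ none → k = j)

theorem Linked.card_le {L : List (Slot D.n)} {μ μ' : Slot D.n → Option (Fiber branch b)}
    (h : Linked A A' L μ μ') :
    D.available id A μ ⊆ D.available id A' μ' ∧
      (D.available id A' μ').card ≤ (D.available id A μ).card + 1 := by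
  rcases h with ⟨w, -, h, -⟩ | ⟨h, -⟩
  · rw [h]
    exact ⟨Finset.subset_insert _ _, Finset.card_insert_le _ _⟩
  · rw [h]
    exact ⟨subset_rfl, Nat.le_succ _⟩

/-- With one extra contract on the side of `μ'`, both sides have the same active seats. The extra
contract is ignored, displaces another contract that becomes the extra one, or fills a seat that `μ`
leaves empty; in the last case the available sets become equal and at most one original seat
differs. With equal available sets, both sides act alike until the shadow seat of that original
seat. There only `μ` can fill, and the contract it takes becomes the extra one. -/
theorem Linked.fillSlot {L : List (Slot D.n)} {t : Slot D.n} (hL : t ∉ L)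
    {μ μ' : Slot D.n → Option (Fiber branch b)} (hμ : μ t = none) (hμ' : μ' t = none)
    (h : Linked A A' (t :: L) μ μ') :
    Linked A A' L (D.fillSlot id A μ t) (D.fillSlot id A' μ' t) := by
  have hr : ∀ {k}, Sum.inr k ∈ L → Sum.inr k ∈ t :: L := List.mem_cons_of_mem _
  have hnone : ∀ {ν : Slot D.n → Option (Fiber branch b)}, ν t = none →
      Function.update ν t none = ν := fun hν => by rw [← hν, Function.update_eq_self]
  rw [fillSlot_eq, fillSlot_eq]
  have hold : ∀ (ν : Slot D.n → Option (Fiber branch b)) c k, Sum.inl k ≠ t →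
      Function.update ν t c (Sum.inl k) = ν (Sum.inl k) :=
    fun ν c k hk => Function.update_of_ne hk _ _
  rcases h with ⟨w, hw, hR, hst⟩ | ⟨hR, hst, huniq⟩
  · have hact : D.Active μ t ↔ D.Active μ' t := by
      rcases t with t | t
      · exact Iff.rfl
      · exact and_congr_right fun _ => hst t (by simp)
    have hsub : D.available id A μ ⊆ D.available id A' μ' := hR ▸ Finset.subset_insert _ _
    rcases hc' : D.pick id A' μ' t with _ | v
    · have hc : D.pick id A μ t = none := by
        unfold pick at hc' ⊢
        split_ifs at hc' ⊢ with h1 h2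
        · exact (D.priority t).max_subset_none hsub hc'
        · exact absurd (hact.1 ‹_›) ‹_›
        all_goals rfl
      rw [hc, hnone hμ, hnone hμ']
      exact Or.inl ⟨w, hw, hR, fun k hk => hst k (hr hk)⟩
    · have hv := mem_available_of_pick hc'
      have hvis : v ∈ D.available id A μ → D.pick id A μ t = some v := fun hv => by
        unfold pick at hc' ⊢
        split_ifs at hc' ⊢ with h1 h2
        · exact (D.priority t).max_subset_some hsub hc' hv
        · exact absurd (hact.2 ‹_›) ‹_›
      rw [hR, Finset.mem_insert] at hv
      rcases hc : D.pick id A μ t with _ | u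
      -- `μ'` fills a seat that `μ` leaves empty, which is possible only with the extra contract. If
      -- `t` is an original seat, it becomes the one seat whose status differs.
      · have hvw : v = w := hv.resolve_right fun h => by simp [hvis h] at hc
        subst hvw
        right
        rw [hnone hμ, available_update hμ', hR, Finset.erase_insert hw]
        refine ⟨rfl, fun k hk h0 => ?_, fun k j hk hj h1 h2 h3 h4 => ?_⟩
        · by_cases hkt : Sum.inl k = t
          · rw [hkt, hμ]
          · rw [hold _ _ _ hkt] at h0
            exact (hst k (hr hk)).2 h0
        · have : ∀ k, Sum.inr k ∈ L → μ (Sum.inl k) = none →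
              Function.update μ' t (some v) (Sum.inl k) ≠ none → Sum.inl k = t := by
            intro k hk h1 h2
            by_contra hkt
            rw [hold _ _ _ hkt] at h2
            exact h2 ((hst k (hr hk)).1 h1)
          exact Sum.inl_injective ((this k hk h1 h2).trans (this j hj h3 h4).symm)
      · left
        have hstat : ∀ k, Sum.inr k ∈ L →
            (Function.update μ t (some u) (Sum.inl k) = none ↔
              Function.update μ' t (some v) (Sum.inl k) = none) := by
          intro k hk
          by_cases hkt : Sum.inl k = t
          · rw [hkt, Function.update_self, Function.update_self]
            simp
          · rw [hold _ _ _ hkt, hold _ _ _ hkt]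
            exact hst k (hr hk)
        have hu := mem_available_of_pick hc
        rw [available_update hμ, available_update hμ', hR]
        -- If `μ'` takes the extra contract, the contract `u` taken by `μ` replaces it as the extra
        -- one; otherwise both sides take the same contract and `w` remains extra.
        by_cases hvw : v = w
        · subst hvw
          refine ⟨u, by simp, ?_, hstat⟩
          rw [Finset.erase_insert hw, Finset.insert_erase hu]
        · have := hvis (hv.resolve_left hvw)
          rw [hc, Option.some.injEq] at this
          subst this
          refine ⟨w, fun h => hw (Finset.mem_of_mem_erase h), ?_, hstat⟩
          rw [Finset.erase_insert_of_ne fun h => hvw h.symm]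
  · by_cases hact : D.Active μ t ↔ D.Active μ' t
    · have hc : D.pick id A' μ' t = D.pick id A μ t := by
        unfold pick
        by_cases ha : D.Active μ t
        · rw [if_pos (hact.1 ha), if_pos ha, hR]
        · rw [if_neg fun h => ha (hact.2 h), if_neg ha]
      rw [hc]
      right
      refine ⟨?_, fun k hk h0 => ?_, fun k j hk hj h1 h2 h3 h4 => ?_⟩
      · rcases D.pick id A μ t with _ | v
        · rw [hnone hμ, hnone hμ', hR]
        · rw [available_update hμ, available_update hμ', hR]
      · by_cases hkt : Sum.inl k = t
        · rw [hkt, Function.update_self] at h0 ⊢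
          exact h0
        · rw [hold _ _ _ hkt] at h0 ⊢
          exact hst k (hr hk) h0
      · have : ∀ k, Function.update μ t (D.pick id A μ t) (Sum.inl k) = none →
            Function.update μ' t (D.pick id A μ t) (Sum.inl k) ≠ none → Sum.inl k ≠ t := by
          intro k h1 h2 hkt
          rw [hkt, Function.update_self] at h1 h2
          exact h2 h1
        have hkt := this k h1 h2
        have hjt := this j h3 h4
        rw [hold _ _ _ hkt] at h1 h2
        rw [hold _ _ _ hjt] at h3 h4
        exact huniq k j (hr hk) (hr hj) h1 h2 h3 h4
    · rcases t with t | t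
      · exact absurd Iff.rfl hact
      have hmem : Sum.inr t ∈ (Sum.inr t :: L : List (Slot D.n)) := by simp
      -- Activity differs, so `t` is the shadow of the one original seat filled only by `μ'`. After
      -- it, the statuses agree for all shadow seats still to come.
      have ht : μ (Sum.inl t) = none ∧ μ' (Sum.inl t) ≠ none := by
        by_contra hnot
        refine hact (and_congr_right fun _ => ⟨fun h => ?_, hst t hmem⟩)
        by_contra h'
        exact hnot ⟨h, h'⟩
      have hstat : ∀ k, Sum.inr k ∈ L → (μ (Sum.inl k) = none ↔ μ' (Sum.inl k) = none) := by
        refine fun k hk => ⟨fun h => ?_, hst k (hr hk)⟩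
        by_contra h'
        have := huniq k t (hr hk) hmem h h' ht.1 ht.2
        exact hL (this ▸ hk)
      have hc' : D.pick id A' μ' (Sum.inr t) = none := if_neg fun h => ht.2 h.2
      rw [hc', hnone hμ']
      rcases hc : D.pick id A μ (Sum.inr t) with _ | u
      · rw [hnone hμ]
        exact Or.inr ⟨hR, fun k hk => (hstat k hk).2,
          fun k j hk _ h1 h2 => absurd ((hstat k hk).1 h1) h2⟩
      · left
        rw [available_update hμ]
        refine ⟨u, by simp, ?_, fun k hk => ?_⟩
        · rw [Finset.insert_erase (mem_available_of_pick hc), hR]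
        · rw [hold _ _ _ (by simp)]
          exact hstat k hk

theorem Linked.foldl_fillSlot (L : List (Slot D.n)) (hL : L.Nodup)
    (μ μ' : Slot D.n → Option (Fiber branch b)) (hμ : ∀ s ∈ L, μ s = none ∧ μ' s = none)
    (h : Linked A A' L μ μ') :
    Linked A A' [] (L.foldl (D.fillSlot id A) μ) (L.foldl (D.fillSlot id A') μ') := by
  induction L generalizing μ μ' with
  | nil => exact h
  | cons t L ih =>
    rw [List.nodup_cons] at hL
    have ht := hμ t (by simp)
    refine ih hL.2 _ _ (fun s hs => ?_) (h.fillSlot hL.1 ht.1 ht.2)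
    have hst : s ≠ t := fun h => hL.1 (h ▸ hs)
    rw [fillSlot_eq, fillSlot_eq, Function.update_of_ne hst, Function.update_of_ne hst]
    exact hμ s (List.mem_cons_of_mem _ hs)

/-- Translates `Linked`, which speaks of unassigned contracts, into statements about chosen ones. It
relies on `id`: a contract becomes unavailable only by being assigned itself. -/
theorem picked_id : D.picked id A = A \ D.available id A (D.assignment id A) := by
  ext x
  rw [mem_picked, Finset.mem_sdiff, mem_available]
  constructor
  · rintro ⟨s, hs⟩
    exact ⟨assignment_mem hs, fun h => h.2 s x hs rfl⟩
  · rintro ⟨hx, h⟩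
    by_contra hno
    refine h ⟨hx, fun s y hs hyx => hno ⟨s, ?_⟩⟩
    rw [hs, Subtype.ext hyx]

/-- The two runs start linked with `z` as the extra contract. At the end the rejected set has only
grown, and by at most one element, while the set of offers grew by exactly one. -/
theorem picked_id_insert {z : Fiber branch b} (hz : z ∉ A) :
    (∀ x ∈ A, x ∈ D.picked id (insert z A) → x ∈ D.picked id A) ∧
      (D.picked id A).card ≤ (D.picked id (insert z A)).card := by
  have hav : ∀ S : Finset (Fiber branch b), D.available id S (fun _ => none) = S := by
    intro S
    ext x
    simp [mem_available]
  have hinit : Linked (D := D) A (insert z A) D.slotOrder (fun _ => none) (fun _ => none) := by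
    left
    rw [hav, hav]
    exact ⟨z, hz, rfl, fun _ _ => Iff.rfl⟩
  obtain ⟨h1, h2⟩ :=
    (Linked.foldl_fillSlot D.slotOrder D.nodup_slotOrder _ _ (by simp) hinit).card_le
  change D.available id A (D.assignment id A) ⊆
    D.available id (insert z A) (D.assignment id (insert z A)) at h1
  change (D.available id (insert z A) (D.assignment id (insert z A))).card ≤
    (D.available id A (D.assignment id A)).card + 1 at h2
  have hsub : ∀ (S : Finset (Fiber branch b)) μ, D.available id S μ ⊆ S :=
    fun S μ x hx => (mem_available.1 hx).1
  rw [picked_id, picked_id]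
  constructor
  · intro x hx hx'
    rw [Finset.mem_sdiff] at hx' ⊢
    exact ⟨hx, fun h => hx'.2 (h1 h)⟩
  · rw [Finset.card_sdiff_of_subset (hsub _ _), Finset.card_sdiff_of_subset (hsub _ _),
      Finset.card_insert_of_notMem hz]
    omega

theorem picked_id_mono (h : A ⊆ A') :
    (∀ x ∈ A, x ∈ D.picked id A' → x ∈ D.picked id A) ∧
      (D.picked id A).card ≤ (D.picked id A').card := by
  have key : ∀ T : Finset (Fiber branch b),
      (∀ x ∈ A, x ∈ D.picked id (T ∪ A) → x ∈ D.picked id A) ∧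
        (D.picked id A).card ≤ (D.picked id (T ∪ A)).card := by
    intro T
    induction T using Finset.induction_on with
    | empty => simp
    | insert z T _ ih =>
      rw [Finset.insert_union]
      by_cases hz : z ∈ T ∪ A
      · rwa [Finset.insert_eq_of_mem hz]
      · obtain ⟨h1, h2⟩ := picked_id_insert (D := D) hz
        exact ⟨fun x hx hx' => ih.1 x hx (h1 x (Finset.mem_union_right _ hx) hx'), ih.2.trans h2⟩
  rw [← Finset.union_eq_left.2 h]
  exact key A'

end Comparison

end Seats

/-! ### The choice rule on contracts of all branches -/

section Choice

variable {agent : X → I} {A : Finset X}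

theorem mem_choice {x : X} : x ∈ D.choice agent A ↔ x ∈ A ∧ ∃ (h : branch x = b) (s : Slot D.n),
    D.assignment agent (open Classical in A.subtype fun y => branch y = b) s = some ⟨x, h⟩ := by
  simp only [choice, Finset.mem_filter]

variable {D}

theorem choice_subset : D.choice agent A ⊆ A := fun _ h => (D.mem_choice.1 h).1

theorem branch_of_mem_choice {x : X} (h : x ∈ D.choice agent A) : branch x = b :=
  (D.mem_choice.1 h).2.1

variable [DecidableEq B]

variable (D agent A) in
theorem choice_eq_map_picked :
    D.choice agent A = (D.picked agent (A.subtype fun y => branch y = b)).map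
      (Function.Embedding.subtype _) := by
  ext x
  rw [mem_choice]
  simp only [Finset.mem_map, Function.Embedding.subtype_apply]
  constructor
  · rintro ⟨hx, h, s, hs⟩
    refine ⟨⟨x, h⟩, mem_picked.2 ⟨s, ?_⟩, rfl⟩
    convert hs
  · rintro ⟨⟨y, hy⟩, hmem, rfl⟩
    obtain ⟨s, hs⟩ := mem_picked.1 hmem
    refine ⟨Finset.mem_subtype.1 (assignment_mem hs), hy, s, ?_⟩
    convert hs

theorem choice_restrict : D.choice agent (restrict branch b A) = D.choice agent A := by
  rw [choice_eq_map_picked, choice_eq_map_picked]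
  congr 2
  ext x
  simp [restrict, x.2]

theorem card_choice_le : (D.choice agent A).card ≤ D.n := by
  rw [choice_eq_map_picked, Finset.card_map]
  exact card_picked_le

/-- The defining property of a completion: the two rules can differ only when `D.choice id` takes
two contracts of one agent. -/
theorem choice_eq_of_injOn
    (h : ∀ x ∈ D.choice id A, ∀ y ∈ D.choice id A, agent x = agent y → x = y) :
    D.choice agent A = D.choice id A := by
  rw [choice_eq_map_picked] at h
  rw [choice_eq_map_picked, choice_eq_map_picked, picked_eq_of_injOn]
  intro x hx y hy hxy
  exact Subtype.ext (h x (Finset.mem_map_of_mem _ hx) y (Finset.mem_map_of_mem _ hy) hxy)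

/-- Substitutability and the law of aggregate demand for the completion; the rest of the argument
uses its seat structure only through these two properties. -/
theorem choice_id_mono {A' : Finset X} (h : A ⊆ A') :
    (∀ x ∈ A, x ∈ D.choice id A' → x ∈ D.choice id A) ∧
      (D.choice id A).card ≤ (D.choice id A').card := by
  classical
  have hsub : (A.subtype fun y => branch y = b) ⊆ A'.subtype fun y => branch y = b :=
    Finset.subtype_mono h
  obtain ⟨h1, h2⟩ := picked_id_mono (D := D) hsub
  simp only [choice_eq_map_picked, Finset.card_map]
  refine ⟨fun x hx hx' => ?_, h2⟩
  obtain ⟨y, hy, rfl⟩ := Finset.mem_map.1 hx'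
  exact Finset.mem_map_of_mem _ (h1 y (Finset.mem_subtype.2 hx) hy)

end Choice

end BranchData

/-- If every `r`-step enlarges the set, every set reaches one from which no step is possible. -/
theorem exists_reflTransGen_maximal {X : Type*} [Finite X] {r : Finset X → Finset X → Prop}
    (hr : ∀ A A', r A A' → A ⊂ A') (A : Finset X) :
    ∃ A', Relation.ReflTransGen r A A' ∧ ∀ A'', ¬ r A' A'' := by
  have := Fintype.ofFinite X
  induction A using (wellFounded_gt : WellFounded ((· > ·) : Finset X → Finset X → Prop)).induction
  with
  | _ A ih =>
    by_cases h : ∃ A', r A A'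
    · obtain ⟨A', h⟩ := h
      obtain ⟨A'', h1, h2⟩ := ih A' (hr _ _ h)
      exact ⟨A'', .head h h1, h2⟩
    · exact ⟨A, .refl, fun A' h' => h ⟨A', h'⟩⟩

/-- For each agent, a strict linear order on her contracts and a set of acceptable contracts. -/
structure ContractOrder {I X : Type*} (agent : X → I) where
  better : X → X → Prop
  acceptable : X → Prop
  agent_eq : ∀ {x y}, better x y → agent x = agent y
  trans : ∀ {x y z}, better x y → better y z → better x z
  irrefl : ∀ x, ¬ better x x
  total : ∀ {x y}, agent x = agent y → x ≠ y → better x y ∨ better y x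

/-! ### Cumulative offers under an abstract choice function -/

namespace ContractOrder

variable {I X : Type*} {agent : X → I} (o o' : ContractOrder agent) (Ch : Finset X → Finset X)

/-- Restrict the acceptable contracts to those that satisfy `p`. -/
def narrow (p : X → Prop) : ContractOrder agent :=
  { o with acceptable := fun x => o.acceptable x ∧ p x }

/-- The two orders agree on the contracts of agent `j`. -/
def AgreeAt (j : I) : Prop :=
  ∀ x, agent x = j → (o.acceptable x ↔ o'.acceptable x) ∧ ∀ y, o.better y x ↔ o'.better y x

/-- An agent without a chosen contract adds to the offers `A` her best acceptable new contract. -/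
def Propose [DecidableEq X] (A A' : Finset X) : Prop :=
  ∃ x, x ∉ A ∧ o.acceptable x ∧ (∀ z ∈ Ch A, agent z ≠ agent x) ∧
    (∀ y, o.acceptable y → o.better y x → y ∈ A) ∧ A' = insert x A

/-- Agents without a chosen contract have offered all their acceptable contracts. -/
def Terminal (A : Finset X) : Prop :=
  ∀ x, o.acceptable x → x ∈ A ∨ ∃ z ∈ Ch A, agent z = agent x

/-- Offers available after finitely many proposals. -/
abbrev Reachable [DecidableEq X] (A : Finset X) : Prop :=
  Relation.ReflTransGen (o.Propose Ch) ∅ A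

/-- Once an offer is rejected, it is rejected from all larger sets of offers. -/
def Substitutable (Ch : Finset X → Finset X) : Prop :=
  ∀ ⦃A A'⦄, A ⊆ A' → ∀ x ∈ A, x ∈ Ch A' → x ∈ Ch A

variable [DecidableEq X] {o o' Ch} {A A' : Finset X}

theorem Propose.ssubset (h : o.Propose Ch A A') : A ⊂ A' := by
  obtain ⟨x, hx, -, -, -, rfl⟩ := h
  exact Finset.ssubset_insert hx

theorem Reachable.acceptable (h : o.Reachable Ch A) {x : X} (hx : x ∈ A) : o.acceptable x := by
  induction h with
  | refl => simp at hx
  | tail _ h ih =>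
    obtain ⟨z, -, hz, -, -, rfl⟩ := h
    rcases Finset.mem_insert.1 hx with rfl | hx
    exacts [hz, ih hx]

theorem Reachable.mem_of_better (h : o.Reachable Ch A) {x y : X} (hx : x ∈ A)
    (hy : o.acceptable y) (hyx : o.better y x) : y ∈ A := by
  induction h with
  | refl => simp at hx
  | tail _ h ih =>
    obtain ⟨z, -, -, -, hz, rfl⟩ := h
    rcases Finset.mem_insert.1 hx with rfl | hx
    exacts [Finset.mem_insert_of_mem (hz y hy hyx), Finset.mem_insert_of_mem (ih hx)]

/-- No agent ever has two chosen contracts. -/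
theorem Reachable.injOn (hsub : ∀ A, Ch A ⊆ A) (hCh : Substitutable Ch)
    (h : o.Reachable Ch A) {x y : X} (hx : x ∈ Ch A) (hy : y ∈ Ch A)
    (hxy : agent x = agent y) : x = y := by
  induction h with
  | refl => simpa using hsub _ hx
  | @tail S _ _ h ih =>
    obtain ⟨z, -, -, hz, -, rfl⟩ := h
    have key : ∀ u ∈ Ch (insert z S), u = z ∨ u ∈ Ch S := fun u hu =>
      (Finset.mem_insert.1 (hsub _ hu)).imp_right fun hu' =>
        hCh (Finset.subset_insert _ _) u hu' hu
    rcases key x hx with rfl | hx' <;> rcases key y hy with rfl | hy'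
    · rfl
    · exact absurd hxy.symm (hz y hy')
    · exact absurd hxy (hz x hx')
    · exact ih hx' hy'

/-- Offers made in one run are made in any complete run with the same preferences of the agents
concerned. -/
theorem Reachable.subset (hsub : ∀ A, Ch A ⊆ A) (hCh : Substitutable Ch) (h : o.Reachable Ch A)
    (h' : o'.Reachable Ch A') (ht : o'.Terminal Ch A')
    (hagree : ∀ x, o.acceptable x → x ∈ A' ∨ o.AgreeAt o' (agent x)) : A ⊆ A' := by
  induction h with
  | refl => simp
  | @tail S S' hS h ih =>
    obtain ⟨x, hxS, hx, hfree, hbest, rfl⟩ := h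
    refine Finset.insert_subset ?_ ih
    rcases hagree x hx with hmem | hag
    · exact hmem
    have hx' : o'.acceptable x := ((hag x rfl).1).1 hx
    by_contra hno
    obtain ⟨z, hz, hzx⟩ := (ht x hx').resolve_left hno
    have hzx' : z ≠ x := fun h => hno (h ▸ hsub _ hz)
    -- A contract `z` better than `x` was offered before `x`, and by substitutability it is still
    -- chosen from `S`, so its agent could not propose. If `x` is the better one, it was offered
    -- before `z` in the other run.
    rcases o'.total hzx hzx' with hb | hb
    · have hzS : z ∈ S :=
        hbest z ((hag z hzx).1.2 (h'.acceptable (hsub _ hz))) (((hag x rfl).2 z).2 hb)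
      exact hfree z (hCh ih z hzS hz) hzx
    · exact hno (h'.mem_of_better (hsub _ hz) hx' hb)

theorem exists_terminal [Finite X] : ∃ A, o.Reachable Ch A ∧ o.Terminal Ch A := by
  obtain ⟨A, hA, hmax⟩ := exists_reflTransGen_maximal
    (fun A A' => Propose.ssubset (o := o) (Ch := Ch) (A := A) (A' := A')) ∅
  refine ⟨A, hA, fun x hx => ?_⟩
  by_contra! hno
  have : IsTrans X o.better := ⟨fun _ _ _ => o.trans⟩
  have : Std.Irrefl o.better := ⟨o.irrefl⟩
  -- With `better` in the role of `<`, a minimal element is a most preferred contract not yet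
  -- offered; its agent could propose it, against maximality of the run.
  obtain ⟨m, ⟨hm, hma, hmx⟩, hmin⟩ := (Finite.wellFounded_of_trans_of_irrefl o.better).has_min
    {y | y ∉ A ∧ o.acceptable y ∧ agent y = agent x} ⟨x, hno.1, hx, rfl⟩
  refine hmax _ ⟨m, hm, hma, fun z hz => hmx ▸ hno.2 z hz, fun y hy hym => ?_, rfl⟩
  by_contra hyA
  exact hmin y ⟨hyA, hy, (o.agent_eq hym).trans hmx⟩ hym

/-- No agent `i` can, by misreporting, obtain a contract `y` that is rejected in the run with her
true preferences together with all contracts that are better. -/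
theorem no_profitable_report [Finite X] [DecidableEq I] (hsub : ∀ A, Ch A ⊆ A)
    (hCh : Substitutable Ch)
    (hlad : ∀ ⦃A A'⦄, A ⊆ A' → (Ch A).card ≤ (Ch A').card)
    (hA : o.Reachable Ch A) (hA' : o'.Reachable Ch A')
    (hAt : o.Terminal Ch A) (hAt' : o'.Terminal Ch A') {i : I}
    (hagree : ∀ j, j ≠ i → o.AgreeAt o' j) {y : X} (hyi : agent y = i)
    (hy : y ∈ Ch A') (hya : o.acceptable y)
    (hrej : ∀ x, o.acceptable x → x = y ∨ o.better x y → x ∈ A \ Ch A) : False := by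
  -- `i` truncates her preferences after `y`
  obtain ⟨T, hT, hTt⟩ := exists_terminal (Ch := Ch)
    (o := o.narrow fun x => agent x = i → x = y ∨ o.better x y)
  -- `i` reports that only `y` is acceptable
  obtain ⟨S, hS, hSt⟩ := exists_terminal (Ch := Ch) (o := o.narrow fun x => agent x = i → x = y)
  -- The only possible offer of `i` in the run `S` is `y`, which lies in `A'`. Hence `S ⊆ A'`, and
  -- substitutability carries the choice of `y` down to `S`.
  have hyS : y ∈ Ch S := by
    have hSA' : S ⊆ A' := by
      refine hS.subset hsub hCh hA' hAt' fun x hx => ?_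
      by_cases hxi : agent x = i
      · rw [hx.2 hxi]
        exact Or.inl (hsub _ hy)
      · refine Or.inr fun z hz => ?_
        have := hagree _ hxi z hz
        refine ⟨?_, this.2⟩
        rw [← this.1]
        exact ⟨fun h => h.1, fun h => ⟨h, fun hzi => absurd (hz ▸ hzi) hxi⟩⟩
    rcases hSt y ⟨hya, fun _ => rfl⟩ with h | ⟨z, hz, hzy⟩
    · exact hCh hSA' y h hy
    · have := (hS.acceptable (hsub _ hz)).2 (hzy.trans hyi)
      exact this ▸ hz
  have hTA : T ⊆ A := by
    refine hT.subset hsub hCh hA hAt fun x hx => ?_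
    by_cases hxi : agent x = i
    · exact Or.inl (Finset.mem_sdiff.1 (hrej x hx.1 (hx.2 hxi))).1
    · exact Or.inr fun z hz => ⟨⟨fun h => h.1, fun h => ⟨h, fun hzi => absurd (hz ▸ hzi) hxi⟩⟩,
        fun _ => Iff.rfl⟩
  -- If `i` obtained some `z` with the truncated report, she would never reach the cut, so the run
  -- would also be complete for her true preferences. Then `T = A`, where `z` is rejected.
  have hfree : ∀ z ∈ Ch T, agent z ≠ i := by
    intro z hz hzi
    have hzT := (hT.acceptable (hsub _ hz))
    have hTo : o.Reachable Ch T := by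
      refine Relation.ReflTransGen.mono (fun U V h => ?_) _ _ hT
      obtain ⟨x, hxU, hx, hf, hb, rfl⟩ := h
      refine ⟨x, hxU, hx.1, hf, fun w hw hwx => hb w ⟨hw, fun hwi => ?_⟩ hwx, rfl⟩
      rcases hx.2 ((o.agent_eq hwx) ▸ hwi) with rfl | h
      exacts [Or.inr hwx, Or.inr (o.trans hwx h)]
    have hTot : o.Terminal Ch T := by
      intro x hx
      by_cases hxi : agent x = i
      · exact Or.inr ⟨z, hz, hzi.trans hxi.symm⟩
      · exact hTt x ⟨hx, fun h => absurd h hxi⟩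
    have hAT : A ⊆ T :=
      hA.subset hsub hCh hTo hTot fun x _ => Or.inr fun _ _ => ⟨Iff.rfl, fun _ => Iff.rfl⟩
    have := Finset.mem_sdiff.1 (hrej z hzT.1 (hzT.2 hzi))
    rw [hAT.antisymm hTA] at this
    exact this.2 hz
  have hyT : y ∈ T := (hTt y ⟨hya, fun _ => Or.inl rfl⟩).resolve_right
    fun ⟨z, hz, hzy⟩ => hfree z hz (hzy.trans hyi)
  have hST : S ⊆ T := by
    refine hS.subset hsub hCh hT hTt fun x hx => ?_
    by_cases hxi : agent x = i
    · rw [hx.2 hxi]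
      exact Or.inl hyT
    · refine Or.inr fun z hz => ⟨and_congr_right fun _ => ?_, fun _ => Iff.rfl⟩
      have hzi : agent z ≠ i := hz ▸ hxi
      exact ⟨fun _ h => absurd h hzi, fun _ h => absurd h hzi⟩
  -- Every agent chosen from `T` is chosen from the smaller set `S`, by substitutability if the same
  -- contract was offered and by terminality otherwise. Agent `i` is chosen only from `S`. With one
  -- contract per agent, this contradicts the law of aggregate demand.
  have himage : (Ch T).image agent ⊂ (Ch S).image agent := by
    refine (Finset.ssubset_iff_of_subset fun j hj => ?_).2
      ⟨i, Finset.mem_image.2 ⟨y, hyS, hyi⟩, fun h => ?_⟩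
    · obtain ⟨x, hx, rfl⟩ := Finset.mem_image.1 hj
      have hxi := hfree x hx
      rcases hSt x ⟨(hT.acceptable (hsub _ hx)).1, fun h => absurd h hxi⟩ with h | ⟨z, hz, hzx⟩
      · exact Finset.mem_image_of_mem _ (hCh hST x h hx)
      · exact Finset.mem_image.2 ⟨z, hz, hzx⟩
    · obtain ⟨x, hx, hxi⟩ := Finset.mem_image.1 h
      exact hfree x hx hxi
  have := Finset.card_lt_card himage
  rw [Finset.card_image_of_injOn fun x hx y hy => hT.injOn hsub hCh hx hy,
    Finset.card_image_of_injOn fun x hx y hy => hS.injOn hsub hCh hx hy] at this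
  exact absurd (hlad hST) (by omega)

end ContractOrder

/-! ### All branches together -/

section Held

variable {I B X K : Type*} [Fintype B] [DecidableEq B] [DecidableEq X]
  {agent : X → I} {branch : X → B} {D : ∀ b : B, BranchData branch b} {A : Finset X}

theorem mem_held {f : X → K} {x : X} :
    x ∈ held branch (fun b => (D b).choice f) A ↔ x ∈ (D (branch x)).choice f A := by
  unfold held
  simp only [BranchData.choice_restrict, Finset.mem_biUnion, Finset.mem_univ, true_and]
  constructor
  · rintro ⟨b, hb⟩
    obtain rfl := BranchData.branch_of_mem_choice hb
    exact hb
  · exact fun h => ⟨_, h⟩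

theorem restrict_held (f : X → K) (b : B) :
    restrict branch b (held branch (fun b => (D b).choice f) A) = (D b).choice f A := by
  ext x
  rw [restrict, Finset.mem_filter, mem_held]
  constructor
  · rintro ⟨h, rfl⟩
    exact h
  · intro h
    obtain rfl := BranchData.branch_of_mem_choice h
    exact ⟨h, rfl⟩

theorem held_subset (f : X → K) (A : Finset X) :
    held branch (fun b => (D b).choice f) A ⊆ A :=
  fun _ h => BranchData.choice_subset (mem_held.1 h)

theorem substitutable_held_id :
    ContractOrder.Substitutable (held branch fun b => (D b).choice id) := by
  intro A A' h x hx hx'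
  rw [mem_held] at hx' ⊢
  exact (BranchData.choice_id_mono h).1 x hx hx'

theorem card_held (f : X → K) :
    (held branch (fun b => (D b).choice f) A).card = ∑ b, ((D b).choice f A).card := by
  unfold held
  simp only [BranchData.choice_restrict]
  refine Finset.card_biUnion fun b _ b' _ hne => Finset.disjoint_left.2 fun x hx hx' => hne ?_
  rw [← BranchData.branch_of_mem_choice hx, BranchData.branch_of_mem_choice hx']

theorem card_held_id_mono {A' : Finset X} (h : A ⊆ A') :
    (held branch (fun b => (D b).choice id) A).card ≤
      (held branch (fun b => (D b).choice id) A').card := by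
  rw [card_held, card_held]
  exact Finset.sum_le_sum fun b _ => (BranchData.choice_id_mono h).2

/-- If the completions hold at most one contract per agent, contracts that are not chosen are
irrelevant for the original choice rules. -/
theorem choice_eq_of_between
    (hA : ∀ x ∈ held branch (fun b => (D b).choice id) A,
      ∀ y ∈ held branch (fun b => (D b).choice id) A, agent x = agent y → x = y)
    {S : Finset X} (hSA : S ⊆ A) {b : B} (hS : (D b).choice id A ⊆ S) :
    (D b).choice agent S = (D b).choice id A := by
  obtain ⟨h1, h2⟩ := BranchData.choice_id_mono (D := D b) hSA
  -- Substitutability gives one inclusion, and the law of aggregate demand turns it into an equality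
  -- by counting.
  have hid : (D b).choice id S = (D b).choice id A :=
    (Finset.eq_of_subset_of_card_le (fun x hx => h1 x (hS hx) hx) h2).symm
  have hmem : ∀ x ∈ (D b).choice id S, x ∈ held branch (fun b => (D b).choice id) A := by
    intro x hx
    rw [hid] at hx
    obtain rfl := BranchData.branch_of_mem_choice hx
    exact mem_held.2 hx
  rw [BranchData.choice_eq_of_injOn, hid]
  exact fun x hx y hy => hA x (hmem x hx) y (hmem y hy)

theorem held_eq_held_id
    (hA : ∀ x ∈ held branch (fun b => (D b).choice id) A,
      ∀ y ∈ held branch (fun b => (D b).choice id) A, agent x = agent y → x = y) :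
    held branch (fun b => (D b).choice agent) A = held branch (fun b => (D b).choice id) A := by
  ext x
  rw [mem_held, mem_held, choice_eq_of_between hA subset_rfl BranchData.choice_subset]

end Held

/-! ### Preference profiles as contract orders -/

section Profile

variable {I X : Type*} {agent : X → I}

/-- The preferences of all agents as one order on contracts. -/
def PrefProfile.toOrder (P : PrefProfile agent) : ContractOrder agent where
  better x y := ∃ (i : I) (hx : agent x = i) (hy : agent y = i),
    (P i).rel (some ⟨x, hx⟩) (some ⟨y, hy⟩)
  acceptable x := (P (agent x)).rel (some ⟨x, rfl⟩) none
  agent_eq := fun ⟨_, hx, hy, _⟩ => hx.trans hy.symm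
  trans := by
    rintro x y z ⟨i, hx, hy, h⟩ ⟨j, hy', hz, h'⟩
    obtain rfl : i = j := hy.symm.trans hy'
    exact ⟨i, hx, hz, (P i).trans h h'⟩
  irrefl := fun x ⟨i, _, _, h⟩ => (P i).irrefl _ h
  total := by
    intro x y h hne
    have := (P (agent x)).total (u := some ⟨x, rfl⟩) (v := some ⟨y, h.symm⟩)
      (by simpa using hne)
    exact this.imp (fun h' => ⟨_, rfl, h.symm, h'⟩) (fun h' => ⟨_, h.symm, rfl, h'⟩)

variable {P : PrefProfile agent}

theorem PrefProfile.toOrder_better {i : I} {x y : X} (hx : agent x = i) (hy : agent y = i) :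
    P.toOrder.better x y ↔ (P i).rel (some ⟨x, hx⟩) (some ⟨y, hy⟩) := by
  refine ⟨?_, fun h => ⟨i, hx, hy, h⟩⟩
  rintro ⟨j, hx', hy', h⟩
  obtain rfl : j = i := hx'.symm.trans hx
  exact h

theorem PrefProfile.toOrder_acceptable {i : I} {x : X} (hx : agent x = i) :
    P.toOrder.acceptable x ↔ (P i).rel (some ⟨x, hx⟩) none := by
  subst hx
  exact Iff.rfl

theorem PrefProfile.agreeAt_toOrder {P' : PrefProfile agent} {j : I} (h : P j = P' j) :
    P.toOrder.AgreeAt P'.toOrder j := by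
  intro x hx
  refine ⟨by rw [toOrder_acceptable hx, toOrder_acceptable hx, h], fun y => ?_⟩
  by_cases hy : agent y = j
  · rw [toOrder_better hy hx, toOrder_better hy hx, h]
  · exact ⟨fun h' => absurd ((P.toOrder.agent_eq h').trans hx) hy,
      fun h' => absurd ((P'.toOrder.agent_eq h').trans hx) hy⟩

variable [DecidableEq I]

theorem max_subtype_eq_some {i : I} {A : Finset X} {x : Fiber agent i} :
    (P i).max (A.subtype fun y => agent y = i) = some x ↔
      (x : X) ∈ A ∧ P.toOrder.acceptable x ∧
        ∀ y ∈ A, agent y = i → y ≠ x → P.toOrder.better x y := by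
  rw [StrictRanking.max_eq_some, Finset.mem_subtype, PrefProfile.toOrder_acceptable x.2]
  refine and_congr_right fun _ => and_congr_right fun _ => ⟨fun h y hy hyi hne => ?_,
    fun h y hy hne => ?_⟩
  · rw [PrefProfile.toOrder_better x.2 hyi]
    exact h ⟨y, hyi⟩ (Finset.mem_subtype.2 hy) fun h => hne (congrArg Subtype.val h)
  · have := h y (Finset.mem_subtype.1 hy) y.2 fun h => hne (Subtype.ext h)
    rwa [PrefProfile.toOrder_better x.2 y.2] at this

theorem mem_agentChoice [DecidableEq X] {i : I} {A : Finset X} {x : X} :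
    x ∈ agentChoice agent P i A ↔ agent x = i ∧ x ∈ A ∧ P.toOrder.acceptable x ∧
      ∀ y ∈ A, agent y = i → y ≠ x → P.toOrder.better x y := by
  unfold agentChoice
  simp only [Finset.mem_map, Option.mem_toFinset, Option.mem_def,
    Function.Embedding.subtype_apply, max_subtype_eq_some]
  constructor
  · rintro ⟨z, h, rfl⟩
    exact ⟨z.2, h⟩
  · rintro ⟨hx, h⟩
    exact ⟨⟨x, hx⟩, h, rfl⟩

end Profile

/-! ### The cumulative offer mechanism -/

section Algorithm

variable {I B X : Type*} [DecidableEq I] [Fintype B] [DecidableEq B] [Fintype X] [DecidableEq X]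
  {agent : X → I} {branch : X → B} {C : B → Finset X → Finset X} {P : PrefProfile agent}
  {A A' : Finset X}

/-- The proposer has no held contract, so for her contracts "offered" and "rejected" mean the same.
Her best contract not rejected is thus a genuinely new offer. -/
theorem OfferStep.propose (h : OfferStep agent branch C P A A') :
    P.toOrder.Propose (held branch C) A A' := by
  obtain ⟨i, hi, x, hx, rfl⟩ := h
  rw [max_subtype_eq_some, Finset.mem_compl] at hx
  have hrej : ∀ y, agent y = i → (y ∈ rejected branch C A ↔ y ∈ A) := fun y hy => by
    rw [rejected, Finset.mem_sdiff, and_iff_left fun h => hi y h hy]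
  refine ⟨x, by rw [← hrej x x.2]; exact hx.1, hx.2.1, fun z hz => x.2.symm ▸ hi z hz,
    fun y _ hyx => ?_, rfl⟩
  have hyi : agent y = i := (P.toOrder.agent_eq hyx).trans x.2
  rw [← hrej y hyi]
  by_contra hno
  have hne : y ≠ x := fun h => P.toOrder.irrefl _ (h ▸ hyx)
  exact P.toOrder.irrefl _
    (P.toOrder.trans hyx (hx.2.2 y (Finset.mem_compl.2 hno) hyi hne))

variable (agent branch C) in
theorem offersTerminate : OffersTerminate agent branch C := by
  rintro P ⟨A, -, hA⟩
  have : StrictMono A := strictMono_nat_of_lt_succ fun t => (hA t).propose.ssubset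
  exact not_injective_infinite_finite A this.injective

theorem exists_isCOMOutcome (P : PrefProfile agent) :
    ∃ Z, IsCOMOutcome agent branch C P Z := by
  obtain ⟨A, hA, hmax⟩ := exists_reflTransGen_maximal
    (r := OfferStep agent branch C P) (fun A A' h => h.propose.ssubset) ∅
  refine ⟨_, A, hA, fun i => ?_, rfl⟩
  by_contra! hno
  obtain ⟨hfree, x, hx, hxr⟩ := hno
  rcases hm : (P i).max ((rejected branch C A)ᶜ.subtype fun y => agent y = i) with _ | y
  · refine StrictRanking.max_eq_none _ |>.1 hm x ?_ hx
    rw [Finset.mem_subtype, Finset.mem_compl]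
    exact hxr
  · exact hmax _ ⟨i, hfree, y, hm, rfl⟩

variable {D : ∀ b : B, BranchData branch b}

/-- By induction: while the steps so far form a run with the completions, these hold at most one
contract per agent. They then agree with the true rules, so the next proposer is also free under the
completions. -/
theorem reachable_of_offerSteps
    (h : Relation.ReflTransGen (OfferStep agent branch (fun b => (D b).choice agent) P) ∅ A) :
    P.toOrder.Reachable (held branch fun b => (D b).choice id) A := by
  induction h with
  | refl => exact .refl
  | tail _ h ih =>
    refine ih.tail ?_
    have heq := held_eq_held_id fun x hx y hy =>
      ih.injOn (held_subset id) substitutable_held_id hx hy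
    obtain ⟨x, h1, h2, h3, h4, h5⟩ := h.propose
    exact ⟨x, h1, h2, heq ▸ h3, h4, h5⟩

/-- The outcome of the algorithm is the outcome of a complete run with the completions. -/
theorem IsCOMOutcome.exists_reachable {Z : Finset X}
    (h : IsCOMOutcome agent branch (fun b => (D b).choice agent) P Z) :
    ∃ A, P.toOrder.Reachable (held branch fun b => (D b).choice id) A ∧
      P.toOrder.Terminal (held branch fun b => (D b).choice id) A ∧
      Z = held branch (fun b => (D b).choice id) A := by
  obtain ⟨A, hA, ht, rfl⟩ := h
  have hr := reachable_of_offerSteps hA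
  have heq : held branch (fun b => (D b).choice agent) A = _ := held_eq_held_id fun x hx y hy =>
    hr.injOn (held_subset id) substitutable_held_id hx hy
  refine ⟨A, hr, fun x hx => ?_, heq⟩
  rw [← heq]
  rcases ht (agent x) with h | h
  · exact Or.inr h
  · exact Or.inl (Finset.mem_sdiff.1 (h ⟨x, rfl⟩ hx)).1

/-- Agents offer in order of preference, so every contract of a blocking set `Y` was offered during
the run. Thus `Z ∪ Y` lies between `Z` and `A`, and the branch chooses from it what it already
holds. -/
theorem IsCOMOutcome.stableOutcome {Z : Finset X}
    (h : IsCOMOutcome agent branch (fun b => (D b).choice agent) P Z) :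
    StableOutcome agent branch (fun b => (D b).n) (fun b => (D b).choice agent) P Z := by
  obtain ⟨A, hr, ht, rfl⟩ := h.exists_reachable
  have hinj := fun x hx y hy => hr.injOn (held_subset id) substitutable_held_id (x := x) (y := y)
    hx hy
  have hchoice : ∀ {S : Finset X} b, held branch (fun b => (D b).choice id) A ⊆ S → S ⊆ A →
      (D b).choice agent S = (D b).choice id A := fun b hS hSA =>
    choice_eq_of_between hinj hSA fun x hx => hS <| by
      obtain rfl := BranchData.branch_of_mem_choice hx
      exact mem_held.2 hx
  have hZA := held_subset (branch := branch) (D := D) id A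
  refine ⟨⟨fun i => Finset.card_le_one.2 fun x hx y hy => ?_, fun b => ?_⟩, fun i => ?_,
    fun b => ?_, ?_⟩
  · rw [restrict, Finset.mem_filter] at hx hy
    exact hinj x hx.1 y hy.1 (hx.2.trans hy.2.symm)
  · rw [restrict_held]
    exact BranchData.card_choice_le
  · ext x
    rw [mem_agentChoice, restrict, Finset.mem_filter]
    refine ⟨fun h => ⟨h.2.1, h.1⟩, fun ⟨hx, hxi⟩ => ⟨hxi, hx, hr.acceptable (hZA hx),
      fun y hy hyi hne => absurd (hinj y hy x hx (hyi.trans hxi.symm)) hne⟩⟩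
  · rw [restrict_held]
    exact hchoice b subset_rfl hZA
  · rintro ⟨b, Y, hne, hYb, hY⟩
    have hYA : Y ⊆ A := by
      intro y hy
      have hmem : y ∈ restrict agent (agent y) Y := by simp [restrict, hy]
      rw [hY _ (Finset.mem_image_of_mem _ hy), mem_agentChoice] at hmem
      obtain ⟨-, -, hacc, hbest⟩ := hmem
      rcases ht y hacc with h | ⟨z, hz, hzy⟩
      · exact h
      · by_cases hne : z = y
        · exact hne ▸ hZA hz
        · exact hr.mem_of_better (hZA hz) hacc
            (hbest z (Finset.mem_union_left _ hz) hzy hne)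
    refine hne ?_
    rw [hYb]
    exact (hchoice b Finset.subset_union_left (Finset.union_subset hZA hYA)).trans
      (hchoice b subset_rfl hZA).symm

/-- A contract `y` gained by misreporting beats what `i` receives truthfully. Hence `y`, and every
acceptable contract better than `y`, was offered and rejected in the truthful run, as
`ContractOrder.no_profitable_report` requires. -/
theorem IsCOMOutcome.not_prefers {Z Z' : Finset X} {i : I} {R : StrictRanking (Fiber agent i)}
    (h : IsCOMOutcome agent branch (fun b => (D b).choice agent) P Z)
    (h' : IsCOMOutcome agent branch (fun b => (D b).choice agent) (Function.update P i R) Z') :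
    ¬ Prefers agent i (P i) Z' Z := by
  rintro ⟨o', o, ho', ho, hlt⟩
  obtain ⟨A, hr, ht, rfl⟩ := h.exists_reachable
  obtain ⟨A', hr', ht', rfl⟩ := h'.exists_reachable
  have hZA := held_subset (branch := branch) (D := D) id A
  have hacc : ∀ x, o = some x → (P i).rel (some x) none := fun x hx =>
    (PrefProfile.toOrder_acceptable x.2).1 (hr.acceptable (hZA ((ho x).2 hx)))
  -- Whatever the truthful run gives is acceptable, so the misreport can only be profitable by
  -- yielding a contract.
  rcases o' with _ | y
  · rcases o with _ | x
    · exact (P i).irrefl _ hlt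
    · exact (P i).asymm hlt (hacc x rfl)
  have hya : (P i).rel (some y) none := by
    rcases o with _ | x
    · exact hlt
    · exact (P i).trans hlt (hacc x rfl)
  refine ContractOrder.no_profitable_report (held_subset id) substitutable_held_id
    (fun _ _ => card_held_id_mono) hr hr' ht ht'
    (fun j hj => PrefProfile.agreeAt_toOrder (by rw [Function.update_of_ne hj])) y.2
    ((ho' y).2 rfl) ((PrefProfile.toOrder_acceptable y.2).2 hya) fun x hx hxy => ?_
  have hxi : agent x = i := by
    rcases hxy with rfl | h
    exacts [y.2, (P.toOrder.agent_eq h).trans y.2]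
  have hxo : (P i).rel (some ⟨x, hxi⟩) o := by
    rcases hxy with rfl | h
    · exact hlt
    · exact (P i).trans ((PrefProfile.toOrder_better hxi y.2).1 h) hlt
  have hxZ : x ∉ held branch (fun b => (D b).choice id) A := fun hmem => by
    rw [← (ho ⟨x, hxi⟩).1 hmem] at hxo
    exact (P i).irrefl _ hxo
  refine Finset.mem_sdiff.2 ⟨?_, hxZ⟩
  rcases ht x hx with h | ⟨z, hz, hzx⟩
  · exact h
  · have := (ho ⟨z, hzx.trans hxi⟩).1 hz
    subst this
    exact hr.mem_of_better (hZA hz) hx ((PrefProfile.toOrder_better hxi _).2 hxo)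

end Algorithm

end SSPwCT

theorem theorem1 {I : Type*} {B : Type*} {X : Type*}
    [Fintype I] [DecidableEq I] [Fintype B] [DecidableEq B] [Fintype X] [DecidableEq X]
    (agent : X → I) (branch : X → B) (D : ∀ b : B, SSPwCT.BranchData branch b) :
    SSPwCT.OffersTerminate agent branch (fun b => (D b).choice agent) ∧
    (∃ Ψ : SSPwCT.Mechanism agent, Ψ.IsCOM branch (fun b => (D b).choice agent)) ∧
    ∀ Ψ : SSPwCT.Mechanism agent, Ψ.IsCOM branch (fun b => (D b).choice agent) →
      Ψ.Stable branch (fun b => (D b).n) (fun b => (D b).choice agent) ∧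
      Ψ.StrategyProof := by
  refine ⟨SSPwCT.offersTerminate _ _ _, ?_, fun Ψ hΨ => ⟨fun P => (hΨ P).stableOutcome, ?_⟩⟩
  · choose Ψ hΨ using SSPwCT.exists_isCOMOutcome (agent := agent) (branch := branch)
      (C := fun b => (D b).choice agent)
    exact ⟨Ψ, hΨ⟩
  · rintro P i ⟨R, hR⟩
    exact (hΨ P).not_prefers (hΨ _) hR
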